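/- Let $p$ be a prime and $r\ge 1$ with $p^r>2$, and let $G=\mathbb{Z}_p^r\rtimes\mathbb{Z}_{p^r-1}$ be a Frobenius group with kernel $\mathbb{Z}_p^r$ and complement $\mathbb{Z}_{p^r-1}$. For a conjugacy class $C$ of $G$ let $A_C$ be the complex $G\times G$ matrix whose $(x,y)$ entry is $1$ if $yx^{-1}\in C$ and $0$ otherwise, and let $E_C^*$ be the diagonal $0,1$ matrix whose $(y,y)$ entry is $1$ exactly when $y\in C$. Let $T(G)$ be the subalgebra of $M_{|G|}(\mathbb{C})$ generated by all $A_C$ and all $E_C^*$. Its primary component $V$ is the irreducible (that is, minimal nonzero) two-sided ideal of $T(G)$ that does not annihilate the primary module $\{M\hat e : M\in\operatorname{Span}_{\mathbb{C}}\{A_C\}\}$, where $\hat e$ is the standard basis vector at the identity $e$ of $G$. Then $G$ has exactly $p^r$ conjugacy classes $C_0=\{e\},C_1,\dots,C_{p^r-1}$; the primary component $V$ exists, is unique and has dimension $p^{2r}$; and the Wedderburn decomposition of $T(G)$ into irreducible two-sided ideals is \[T(G)=V\oplus W_1\oplus W_2\oplus\cdots\oplus W_{p^r-1},\] where each $W_i$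 is the one-dimensional ideal $W_i=\operatorname{Span}_{\mathbb{C}}(B_i)$. Here $B_i$ is the $|G|\times|G|$ matrix indexed by $G$ which is $0$ outside the $C_i,C_i$ block and whose $C_i,C_i$ block is \[-\frac{1}{|C_i|-1}J+\left(1+\frac{1}{|C_i|-1}\right)I,\] with $J$ the all-ones matrix and $I$ the identity matrix of size $|C_i|$. Moreover the scalar multiple $\frac{|C_i|-1}{|C_i|}B_i$ is idempotent, so each $W_i$ is spanned by an idempotent. -/

import Mathlib

noncomputable section

/-- `G` is a Frobenius group with Frobenius kernel `K` and Frobenius complement `H`: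
`H` is a nontrivial proper subgroup which meets each of its conjugates `g H g⁻¹`, `g ∉ H`, trivially,
and `K` is a normal complement of `H`, so that `G = K ⋊ H`. -/
structure IsFrobeniusGroup {G : Type*} [Group G] (K H : Subgroup G) : Prop where
  complement_ne_bot : H ≠ ⊥
  complement_ne_top : H ≠ ⊤
  inf_conj_eq_bot : ∀ g : G, g ∉ H → H ⊓ H.map (MulAut.conj g).toMonoidHom = ⊥
  kernel_normal : K.Normal
  isComplement : Subgroup.IsComplement' K H

section Scheme

variable {ι Ω : Type*} [Fintype Ω] [DecidableEq Ω]

/-- The Bose-Mesner algebra of the scheme with adjacency matrices `A i`: the span of the `A i`. -/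
def boseMesner (A : ι → Matrix Ω Ω ℂ) : Submodule ℂ (Matrix Ω Ω ℂ) :=
  Submodule.span ℂ (Set.range A)

/-- The dual idempotent `E_i^*(x)`: the diagonal matrix whose `(y, y)` entry is `1` if `(x, y)`
lies in the `i`-th relation and `0` otherwise, that is, the `(x, y)` entry of `A i`. -/
def dualIdempotent (A : ι → Matrix Ω Ω ℂ) (x : Ω) (i : ι) : Matrix Ω Ω ℂ :=
  Matrix.diagonal fun y => A i x y

/-- The dual Bose-Mesner algebra with base point `x`: the span of the `E_i^*(x)`. -/
def dualBoseMesner (A : ι → Matrix Ω Ω ℂ) (x : Ω) : Submodule ℂ (Matrix Ω Ω ℂ) :=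
  Submodule.span ℂ (Set.range (dualIdempotent A x))

/-- The Terwilliger algebra with base point `x`: the subalgebra of the full matrix algebra generated
by the Bose-Mesner algebra and the dual Bose-Mesner algebra. -/
def terwilligerAlgebra (A : ι → Matrix Ω Ω ℂ) (x : Ω) : Subalgebra ℂ (Matrix Ω Ω ℂ) :=
  Algebra.adjoin ℂ ((boseMesner A : Set (Matrix Ω Ω ℂ)) ∪ dualBoseMesner A x)

/-- The primary module `{M x̂ : M in the Bose-Mesner algebra}`, where `x̂` is the standard basis
vector at the base point `x`. -/
def primaryModule (A : ι → Matrix Ω Ω ℂ) (x : Ω) : Set (Ω → ℂ) :=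
  {v | ∃ M ∈ boseMesner A, v = Matrix.mulVec M (Pi.single x 1)}

/-- The primary component of the Terwilliger algebra: the irreducible (minimal nonzero two-sided)
ideal which does not annihilate the primary module. -/
structure IsPrimaryComponent (A : ι → Matrix Ω Ω ℂ) (x : Ω)
    (V : TwoSidedIdeal (terwilligerAlgebra A x)) : Prop where
  irreducible : IsAtom V
  acts : ∃ t ∈ V, ∃ v ∈ primaryModule A x, Matrix.mulVec (t : Matrix Ω Ω ℂ) v ≠ 0

end Scheme

/-- A two-sided ideal of a complex algebra, as a complex subspace. -/
def idealSubspace {R : Type*} [Ring R] [Algebra ℂ R] (I : TwoSidedIdeal R) : Submodule ℂ R :=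
  (TwoSidedIdeal.asIdeal I).restrictScalars ℂ

open Classical in
/-- A Wedderburn decomposition: `R` is the internal direct sum of the irreducible (minimal nonzero)
two-sided ideals `I k`. -/
structure IsWedderburnDecomposition {R κ : Type*} [Ring R] [Algebra ℂ R]
    (I : κ → TwoSidedIdeal R) : Prop where
  irreducible : ∀ k, IsAtom (I k)
  isInternal : DirectSum.IsInternal fun k => idealSubspace (I k)

section Group

variable (G : Type*) [Group G]

open Classical in
/-- The adjacency matrices of the group association scheme, indexed by the conjugacy classes:
the `(x, y)` entry is `1` if `y x⁻¹` lies in the class `c` and `0` otherwise. -/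
def groupScheme (c : ConjClasses G) : Matrix G G ℂ :=
  Matrix.of fun x y => if y * x⁻¹ ∈ c.carrier then 1 else 0

variable [Fintype G] [DecidableEq G]

/-- `T(G)`: the Terwilliger algebra of the group association scheme with base point the identity. -/
abbrev groupTerwilliger : Subalgebra ℂ (Matrix G G ℂ) :=
  terwilligerAlgebra (groupScheme G) 1

open Classical in
/-- The matrix which is `0` outside the `c, c` block and whose `c, c` block is
`-1/(|c| - 1) J + (1 - (-1/(|c| - 1))) I`. -/
def blockMatrix (c : ConjClasses G) : Matrix G G ℂ :=
  Matrix.of fun x y =>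
    if x ∈ c.carrier ∧ y ∈ c.carrier then
      -1 / ((c.carrier.ncard : ℂ) - 1)
        + (1 - -1 / ((c.carrier.ncard : ℂ) - 1)) * (1 : Matrix G G ℂ) x y
    else 0

end Group

end

/-! The Frobenius action makes the conjugacy classes explicit: `{1}`, `K \ {1}`, and the cosets of
`K` other than `K`. So nonidentity elements are conjugate exactly when they lie in the same coset of
`K` (`isConj_iff_mul_inv_mem`). For `x ≠ y`, the class of `y * x⁻¹` then depends only on the cosets
of `x` and `y`, hence only on their classes, and each adjacency matrix is constant on class blocks
away from the diagonal (`groupScheme_eq_blockPattern`).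

Therefore `T(G)` consists of all matrices that are block-constant plus a scalar multiple of the
identity on each diagonal block (`mem_terwilligerAlgebra_iff`). Block-constant matrices form an
ideal that behaves like a full matrix algebra with one row per class; this is the primary component.
On a class of size `n`, the matrix `n I - J` annihilates block-constant matrices on both sides, so
it spans an ideal of dimension at most one, which vanishes only when `n = 1`. Since `I = (1/n) J +
(1/n) (n I - J)` on each block, these ideals fill the algebra (`isWedderburnDecomposition`). -/

set_option linter.unusedSectionVars false

/-! ### Calculus of block patterns for the fibres of a map. -/

section BlockPattern

open Finset

variable {Ω ι : Type*} [Fintype Ω] [DecidableEq Ω] [DecidableEq ι] (π : Ω → ι)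

/-- The matrix whose entries are constant on the blocks cut out by the fibres of `π`, given there
by `α`, plus a multiple `β a` of the identity on each diagonal block. -/
def blockPattern (α : ι → ι → ℂ) (β : ι → ℂ) : Matrix Ω Ω ℂ :=
  Matrix.of fun x y => α (π x) (π y) + if x = y then β (π x) else 0

/-- The number of points in the fibre over `c`. -/
def fiberCard (c : ι) : ℂ := #{x | π x = c}

/-- `|c|` times the identity minus the all-ones matrix on the diagonal block `c`. -/
def centeredBlock (c : ι) : Matrix Ω Ω ℂ :=
  blockPattern π (fun a b => if a = c ∧ b = c then -1 else 0)
    fun a => if a = c then fiberCard π c else 0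

/-- The all-ones matrix on the block `a, b`. -/
def onesBlock (a b : ι) : Matrix Ω Ω ℂ :=
  blockPattern π (fun c d => if c = a ∧ d = b then 1 else 0) 0

variable {π}

theorem blockPattern_apply (α : ι → ι → ℂ) (β : ι → ℂ) (x y : Ω) :
    blockPattern π α β x y = α (π x) (π y) + if x = y then β (π x) else 0 := rfl

theorem blockPattern_add (α α' : ι → ι → ℂ) (β β' : ι → ℂ) :
    blockPattern π α β + blockPattern π α' β' = blockPattern π (α + α') (β + β') := by
  ext x y
  simp only [Matrix.add_apply, blockPattern_apply, Pi.add_apply]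
  split_ifs <;> ring

theorem smul_blockPattern (s : ℂ) (α : ι → ι → ℂ) (β : ι → ℂ) :
    s • blockPattern π α β = blockPattern π (s • α) (s • β) := by
  ext x y
  simp only [Matrix.smul_apply, blockPattern_apply, Pi.smul_apply, smul_eq_mul]
  split_ifs <;> ring

theorem blockPattern_mul (α α' : ι → ι → ℂ) (β β' : ι → ℂ) :
    blockPattern π α β * blockPattern π α' β' =
      blockPattern π (fun a b => ∑ z, α a (π z) * α' (π z) b + β a * α' a b + α a b * β' b)
        (β * β') := by
  ext x y
  simp only [Matrix.mul_apply, blockPattern_apply, Pi.mul_apply, add_mul, mul_add, ite_mul,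
    mul_ite, zero_mul, mul_zero, sum_add_distrib, sum_ite_eq, sum_ite_eq', mem_univ, if_true]
  split_ifs with h
  · subst h; ring
  · ring

theorem sum_fiber (c : ι) (s : ℂ) : (∑ z : Ω, if π z = c then s else 0) = fiberCard π c * s := by
  rw [← sum_filter, sum_const, nsmul_eq_mul, fiberCard]

/-- The columns of `n I - J` sum to zero, so the block-constant factor dies and only the scalar on
block `c` survives. -/
theorem blockPattern_mul_centeredBlock (α : ι → ι → ℂ) (β : ι → ℂ) (c : ι) :
    blockPattern π α β * centeredBlock π c = β c • centeredBlock π c := by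
  rw [centeredBlock, blockPattern_mul, smul_blockPattern]
  congr 1
  · ext a b
    have h : ∀ z, α a (π z) * (if π z = c ∧ b = c then (-1 : ℂ) else 0) =
        if π z = c then (if b = c then -α a c else 0) else 0 := by
      intro z
      by_cases h1 : π z = c <;> by_cases h2 : b = c <;> simp [h1, h2]
    simp only [h, sum_fiber, Pi.smul_apply, smul_eq_mul]
    by_cases h1 : a = c <;> by_cases h2 : b = c <;> simp [h1, h2] <;> ring
  · ext a
    by_cases h1 : a = c <;> simp [h1]

theorem centeredBlock_mul_blockPattern (α : ι → ι → ℂ) (β : ι → ℂ) (c : ι) :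
    centeredBlock π c * blockPattern π α β = β c • centeredBlock π c := by
  rw [centeredBlock, blockPattern_mul, smul_blockPattern]
  congr 1
  · ext a b
    have h : ∀ z, (if a = c ∧ π z = c then (-1 : ℂ) else 0) * α (π z) b =
        if π z = c then (if a = c then -α c b else 0) else 0 := by
      intro z
      by_cases h1 : π z = c <;> by_cases h2 : a = c <;> simp [h1, h2]
    simp only [h, sum_fiber, Pi.smul_apply, smul_eq_mul]
    by_cases h1 : a = c <;> by_cases h2 : b = c <;> simp [h1, h2]
  · ext a
    by_cases h1 : a = c <;> simp [h1, mul_comm]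

theorem centeredBlock_mul_self (c : ι) :
    centeredBlock π c * centeredBlock π c = fiberCard π c • centeredBlock π c := by
  conv_lhs => enter [1]; rw [centeredBlock]
  rw [blockPattern_mul_centeredBlock, if_pos rfl]

/-- The all-ones blocks are matrix units up to scaling: they isolate one coefficient and move it to
any other block. -/
theorem onesBlock_mul_blockPattern_mul_onesBlock (α : ι → ι → ℂ) (a b c d : ι) :
    onesBlock π c a * blockPattern π α 0 * onesBlock π b d =
      (fiberCard π a * fiberCard π b * α a b) • onesBlock π c d := by
  have h : ∀ (a b : ι) (e : ι → ι → ℂ), onesBlock π a b * blockPattern π e 0 =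
      blockPattern π (fun s t => if s = a then fiberCard π b * e b t else 0) 0 := by
    intro a b e
    rw [onesBlock, blockPattern_mul]
    congr 1
    · ext s t
      have h : ∀ z, (if s = a ∧ π z = b then (1 : ℂ) else 0) * e (π z) t =
          if π z = b then (if s = a then e b t else 0) else 0 := by
        intro z
        by_cases h1 : π z = b <;> by_cases h2 : s = a <;> simp [h1, h2]
      simp only [h, sum_fiber]
      by_cases h2 : s = a <;> simp [h2]
    · simp
  rw [h, onesBlock, blockPattern_mul, onesBlock, smul_blockPattern]
  congr 1
  · ext s t
    have h : ∀ z, (if s = c then fiberCard π a * α a (π z) else 0) *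
        (if π z = b ∧ t = d then (1 : ℂ) else 0) =
          if π z = b then (if s = c ∧ t = d then fiberCard π a * α a b else 0) else 0 := by
      intro z
      by_cases h1 : π z = b <;> by_cases h2 : s = c <;> by_cases h3 : t = d <;> simp [h1, h2, h3]
    simp only [h, sum_fiber]
    by_cases h2 : s = c <;> by_cases h3 : t = d <;> simp [h2, h3]; ring
  · simp

theorem blockPattern_eq_add_sum [Fintype ι] {α : ι → ι → ℂ} {β : ι → ℂ}
    (hn : ∀ c, fiberCard π c ≠ 0) :
    blockPattern π α β =
      blockPattern π (fun a b => α a b + if a = b then β a / fiberCard π a else 0) 0 +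
        ∑ c, (β c / fiberCard π c) • centeredBlock π c := by
  ext x y
  simp only [Matrix.add_apply, Matrix.sum_apply, Matrix.smul_apply, centeredBlock,
    blockPattern_apply, smul_eq_mul, mul_add, sum_add_distrib]
  have h1 : ∀ c, β c / fiberCard π c * (if π x = c ∧ π y = c then (-1 : ℂ) else 0) =
      if π x = c then (if π x = π y then -(β c / fiberCard π c) else 0) else 0 := by
    intro c
    by_cases h1 : π x = c
    · subst h1
      by_cases h2 : π y = π x <;> simp [h2, eq_comm]
      simp [Ne.symm h2]
    · simp [h1]
  have h2 : ∀ c, β c / fiberCard π c *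
      (if x = y then (if π x = c then fiberCard π c else 0) else 0) =
      if π x = c then (if x = y then β c else 0) else 0 := by
    intro c
    have := hn c
    by_cases h1 : π x = c <;> by_cases h2 : x = y <;> simp [h1, h2]
    · field_simp
    · simp [← h2, h1]
  simp only [h1, h2, sum_ite_eq, mem_univ, if_true]
  by_cases h : π x = π y <;> simp [h]

/-- With zero diagonal part the coefficients are entries of the matrix. In general they are
ambiguous, since on a one-point fibre `α` and `β` are seen only through their sum. -/
theorem blockPattern_eq_zero_iff (hπ : Function.Surjective π) (α : ι → ι → ℂ) :
    blockPattern π α 0 = 0 ↔ α = 0 := by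
  constructor
  · intro h
    ext a b
    obtain ⟨x, rfl⟩ := hπ a
    obtain ⟨y, rfl⟩ := hπ b
    simpa [blockPattern_apply] using congrFun (congrFun h x) y
  · rintro rfl
    ext x y
    simp [blockPattern_apply]

theorem centeredBlock_apply_self (x : Ω) :
    centeredBlock π (π x) x x = fiberCard π (π x) - 1 := by
  simp [centeredBlock, blockPattern_apply]; ring

/-- Multiplying the relation by one centered block kills every term but its own. -/
theorem eq_zero_of_blockPattern_add_sum_eq_zero {κ : Type*} [Fintype κ] {f : κ → ι}
    (hf : Function.Injective f) {α : ι → ι → ℂ} {s : κ → ℂ} (hn : ∀ c, fiberCard π c ≠ 0)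
    (hc : ∀ k, centeredBlock π (f k) ≠ 0)
    (h : blockPattern π α 0 + ∑ k, s k • centeredBlock π (f k) = 0) (k : κ) : s k = 0 := by
  classical
  have h1 := congrArg (· * centeredBlock π (f k)) h
  have h2 : ∀ d, centeredBlock π (f d) * centeredBlock π (f k) =
      (if k = d then fiberCard π (f d) else 0) • centeredBlock π (f k) := fun d => by
    conv_lhs => enter [1]; rw [centeredBlock]
    rw [blockPattern_mul_centeredBlock]
    simp only [hf.eq_iff]
  simp only [add_mul, sum_mul, Matrix.smul_mul, h2, blockPattern_mul_centeredBlock, smul_smul,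
    ← sum_smul, mul_ite, mul_zero, sum_ite_eq, mem_univ, if_true, Pi.zero_apply, zero_smul,
    zero_add, zero_mul, smul_eq_zero, mul_eq_zero, hn, hc, or_false] at h1
  exact h1

end BlockPattern

/-! ### Minimal ideals and the Wedderburn decomposition. -/

section BlockPatternIdeals

open Finset

variable {Ω ι : Type*} [Fintype Ω] [DecidableEq Ω] [DecidableEq ι] {π : Ω → ι}
  {T : Subalgebra ℂ (Matrix Ω Ω ℂ)}

/-- The ideal of the matrices which are constant on all blocks. -/
def constantIdeal (hT : ∀ M, M ∈ T ↔ ∃ α β, M = blockPattern π α β) : TwoSidedIdeal T :=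
  TwoSidedIdeal.mk' {t | ∃ α, (t : Matrix Ω Ω ℂ) = blockPattern π α 0}
    ⟨0, by ext; simp [blockPattern_apply]⟩
    (by
      rintro x y ⟨α, hx⟩ ⟨α', hy⟩
      exact ⟨α + α', by simp [hx, hy, blockPattern_add]⟩)
    (by
      rintro x ⟨α, hx⟩
      exact ⟨-α, by ext; simp [hx, blockPattern_apply]⟩)
    (by
      rintro x y ⟨α, hy⟩
      obtain ⟨α', β, hx⟩ := (hT x).1 x.2
      exact ⟨_, by rw [MulMemClass.coe_mul, hx, hy, blockPattern_mul, mul_zero]⟩)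
    (by
      rintro x y ⟨α, hx⟩
      obtain ⟨α', β, hy⟩ := (hT y).1 y.2
      exact ⟨_, by rw [MulMemClass.coe_mul, hx, hy, blockPattern_mul, zero_mul]⟩)

/-- The ideal spanned by `centeredBlock π c`. -/
def centeredIdeal (hT : ∀ M, M ∈ T ↔ ∃ α β, M = blockPattern π α β) (c : ι) :
    TwoSidedIdeal T :=
  TwoSidedIdeal.mk' {t | ∃ s : ℂ, (t : Matrix Ω Ω ℂ) = s • centeredBlock π c}
    ⟨0, by simp⟩
    (by
      rintro x y ⟨s, hx⟩ ⟨s', hy⟩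
      exact ⟨s + s', by simp [hx, hy, add_smul]⟩)
    (by
      rintro x ⟨s, hx⟩
      exact ⟨-s, by simp [hx]⟩)
    (by
      rintro x y ⟨s, hy⟩
      obtain ⟨α', β, hx⟩ := (hT x).1 x.2
      exact ⟨s * β c, by
        rw [MulMemClass.coe_mul, hx, hy, Matrix.mul_smul, blockPattern_mul_centeredBlock,
          smul_smul]⟩)
    (by
      rintro x y ⟨s, hx⟩
      obtain ⟨α', β, hy⟩ := (hT y).1 y.2
      exact ⟨s * β c, by
        rw [MulMemClass.coe_mul, hx, hy, Matrix.smul_mul, centeredBlock_mul_blockPattern,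
          smul_smul]⟩)

open Classical in
theorem IsWedderburnDecomposition.of_iSupIndep {R κ : Type*} [Ring R] [Algebra ℂ R]
    {I : κ → TwoSidedIdeal R} (hatom : ∀ k, IsAtom (I k))
    (hind : iSupIndep fun k => idealSubspace (I k)) (htop : ⨆ k, idealSubspace (I k) = ⊤) :
    IsWedderburnDecomposition I :=
  ⟨hatom, DirectSum.isInternal_submodule_of_iSupIndep_of_iSup_eq_top hind htop⟩

variable (hT : ∀ M, M ∈ T ↔ ∃ α β, M = blockPattern π α β)

theorem mem_constantIdeal {t : T} :
    t ∈ constantIdeal hT ↔ ∃ α, (t : Matrix Ω Ω ℂ) = blockPattern π α 0 := by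
  simp [constantIdeal]

theorem mem_centeredIdeal {c : ι} {t : T} :
    t ∈ centeredIdeal hT c ↔ ∃ s : ℂ, (t : Matrix Ω Ω ℂ) = s • centeredBlock π c := by
  simp [centeredIdeal]

theorem mem_idealSubspace {R : Type*} [Ring R] [Algebra ℂ R] {I : TwoSidedIdeal R} {x : R} :
    x ∈ idealSubspace I ↔ x ∈ I := by
  simp [idealSubspace]

theorem TwoSidedIdeal.isAtom_of_forall_mem {R : Type*} [Ring R] {I : TwoSidedIdeal R}
    (hI : I ≠ ⊥) (h : ∀ J : TwoSidedIdeal R, ∀ x ∈ J, x ∈ I → x ≠ 0 → ∀ y ∈ I, y ∈ J) :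
    IsAtom I := by
  refine ⟨hI, fun J hJ => ?_⟩
  by_contra hne
  have : ∃ x ∈ J, x ≠ 0 := by
    by_contra! h0
    exact hne (le_bot_iff.1 fun x hx => (TwoSidedIdeal.mem_bot _).2 (h0 x hx))
  obtain ⟨x, hx, hx0⟩ := this
  exact hJ.not_ge fun y hy => h J x hx (hJ.le hx) hx0 y hy

theorem TwoSidedIdeal.algebra_smul_mem {R : Type*} [Ring R] [Algebra ℂ R] (I : TwoSidedIdeal R)
    (s : ℂ) {x : R} (hx : x ∈ I) : s • x ∈ I := by
  rw [← mem_idealSubspace] at hx ⊢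
  exact Submodule.smul_mem _ _ hx

theorem TwoSidedIdeal.ne_bot_of_mem {R : Type*} [Ring R] {I : TwoSidedIdeal R} {x : R}
    (hx : x ∈ I) (h0 : x ≠ 0) : I ≠ ⊥ := by
  rintro rfl
  exact h0 ((TwoSidedIdeal.mem_bot _).1 hx)

include hT

theorem blockPattern_mem (α : ι → ι → ℂ) (β : ι → ℂ) : blockPattern π α β ∈ T :=
  (hT _).2 ⟨α, β, rfl⟩

theorem blockPattern_mem_constantIdeal (α : ι → ι → ℂ) :
    (⟨blockPattern π α 0, blockPattern_mem hT α 0⟩ : T) ∈ constantIdeal hT :=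
  (mem_constantIdeal hT).2 ⟨α, rfl⟩

theorem isAtom_constantIdeal [Fintype ι] (hn : ∀ c, fiberCard π c ≠ 0)
    (hπ : Function.Surjective π) [Nonempty ι] : IsAtom (constantIdeal hT) := by
  apply TwoSidedIdeal.isAtom_of_forall_mem
  · refine TwoSidedIdeal.ne_bot_of_mem (x := ⟨blockPattern π 1 0, blockPattern_mem hT _ _⟩)
      ((mem_constantIdeal hT).2 ⟨_, rfl⟩) fun h => ?_
    have := (blockPattern_eq_zero_iff hπ _).1 (congrArg Subtype.val h)
    exact one_ne_zero this
  · intro J x hxJ hxI hx0 y hy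
    obtain ⟨α, hx⟩ := (mem_constantIdeal hT).1 hxI
    obtain ⟨α', hy⟩ := (mem_constantIdeal hT).1 hy
    have hα : α ≠ 0 := by
      rintro rfl
      exact hx0 (Subtype.ext (hx.trans ((blockPattern_eq_zero_iff hπ _).2 rfl)))
    obtain ⟨a, ha⟩ := Function.ne_iff.1 hα
    obtain ⟨b, hb⟩ := Function.ne_iff.1 ha
    have hones : ∀ c d, onesBlock π c d ∈ T := fun c d => blockPattern_mem hT _ _
    have hJ : ∀ c d, (⟨onesBlock π c d, hones c d⟩ : T) ∈ J := by
      intro c d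
      -- Simplicity as for a full matrix algebra: sandwich `x` around its nonzero coefficient `α a
      -- b` and normalize.
      have h1 := J.algebra_smul_mem (fiberCard π a * fiberCard π b * α a b)⁻¹
        (J.mul_mem_right _ ⟨_, hones b d⟩ (J.mul_mem_left ⟨_, hones c a⟩ _ hxJ))
      convert h1
      simp only [MulMemClass.coe_mul, hx, SetLike.val_smul]
      rw [onesBlock_mul_blockPattern_mul_onesBlock, smul_smul, inv_mul_cancel₀, one_smul]
      exact mul_ne_zero (mul_ne_zero (hn a) (hn b)) hb
    have h2 : y = ∑ c, ∑ d, α' c d • (⟨onesBlock π c d, hones c d⟩ : T) := by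
      apply Subtype.ext
      ext u v
      simp only [hy, AddSubmonoidClass.coe_finsetSum, SetLike.val_smul, Matrix.sum_apply,
        Matrix.smul_apply, onesBlock, blockPattern_apply]
      simp [ite_and]
    rw [h2]
    exact sum_mem fun c _ => sum_mem fun d _ => J.algebra_smul_mem _ (hJ c d)

theorem isAtom_centeredIdeal {c : ι} (hc : centeredBlock π c ≠ 0) :
    IsAtom (centeredIdeal hT c) := by
  apply TwoSidedIdeal.isAtom_of_forall_mem
  · refine TwoSidedIdeal.ne_bot_of_mem (x := ⟨centeredBlock π c, blockPattern_mem hT _ _⟩)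
      ((mem_centeredIdeal hT).2 ⟨1, (one_smul _ _).symm⟩) fun h => hc (congrArg Subtype.val h)
  · intro J x hxJ hxI hx0 y hy
    obtain ⟨s, hx⟩ := (mem_centeredIdeal hT).1 hxI
    obtain ⟨s', hy⟩ := (mem_centeredIdeal hT).1 hy
    have hs : s ≠ 0 := by
      rintro rfl
      exact hx0 (Subtype.ext (by simpa using hx))
    have : y = (s' / s) • x := Subtype.ext (by
      rw [SetLike.val_smul, hx, hy, smul_smul, div_mul_cancel₀ _ hs])
    rw [this]
    exact J.algebra_smul_mem _ hxJ

theorem finrank_constantIdeal [Fintype ι] (hπ : Function.Surjective π) :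
    Module.finrank ℂ (idealSubspace (constantIdeal hT)) = Fintype.card ι ^ 2 := by
  let f : (ι → ι → ℂ) →ₗ[ℂ] T :=
    { toFun := fun α => ⟨blockPattern π α 0, blockPattern_mem hT _ _⟩
      map_add' := fun α α' => Subtype.ext (by simp [blockPattern_add])
      map_smul' := fun s α => Subtype.ext (by simp [smul_blockPattern]) }
  have hf : Function.Injective f := by
    rw [injective_iff_map_eq_zero]
    exact fun α hα => (blockPattern_eq_zero_iff hπ _).1 (congrArg Subtype.val hα)
  have h : idealSubspace (constantIdeal hT) = LinearMap.range f := by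
    ext t
    rw [mem_idealSubspace, mem_constantIdeal, LinearMap.mem_range]
    exact ⟨fun ⟨α, h⟩ => ⟨α, Subtype.ext h.symm⟩, fun ⟨α, h⟩ => ⟨α, congrArg Subtype.val h.symm⟩⟩
  rw [h, LinearMap.finrank_range_of_inj hf, Module.finrank_pi_fintype]
  simp [sq]

theorem map_centeredIdeal (c : ι) :
    (idealSubspace (centeredIdeal hT c)).map T.val.toLinearMap =
      Submodule.span ℂ {centeredBlock π c} := by
  ext M
  rw [Submodule.mem_map, Submodule.mem_span_singleton]
  constructor
  · rintro ⟨t, ht, rfl⟩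
    obtain ⟨s, hs⟩ := (mem_centeredIdeal hT).1 (mem_idealSubspace.1 ht)
    exact ⟨s, hs.symm⟩
  · rintro ⟨s, rfl⟩
    exact ⟨⟨_, T.smul_mem (blockPattern_mem hT _ _) s⟩,
      mem_idealSubspace.2 ((mem_centeredIdeal hT).2 ⟨s, rfl⟩), rfl⟩

theorem finrank_centeredIdeal {c : ι} (hc : centeredBlock π c ≠ 0) :
    Module.finrank ℂ (idealSubspace (centeredIdeal hT c)) = 1 := by
  have h := (Submodule.equivMapOfInjective T.val.toLinearMap Subtype.val_injective
    (idealSubspace (centeredIdeal hT c))).finrank_eq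
  rw [h, map_centeredIdeal, finrank_span_singleton hc]

/-- The predicate `P` allows the summands to be indexed by any description of the nonvanishing
blocks, such as `c ≠ 1`. -/
theorem isWedderburnDecomposition [Fintype ι] (hπ : Function.Surjective π) [Nonempty ι]
    (P : ι → Prop) (hP : ∀ c, P c ↔ centeredBlock π c ≠ 0) :
    IsWedderburnDecomposition fun k : Option {c // P c} =>
      k.elim (constantIdeal hT) fun c => centeredIdeal hT c := by
  have hn : ∀ c, fiberCard π c ≠ 0 := fun c => by
    obtain ⟨x, rfl⟩ := hπ c
    exact Nat.cast_ne_zero.2 (card_ne_zero.2 ⟨x, by simp⟩)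
  refine .of_iSupIndep ?_ ?_ ?_
  · rintro (_ | c)
    · exact isAtom_constantIdeal hT hn hπ
    · exact isAtom_centeredIdeal hT ((hP _).1 c.2)
  · classical
    rw [iSupIndep_iff_finsetSum_eq_zero_imp_eq_zero]
    intro S v hv hsum
    have hw : ∀ i, (if i ∈ S then v i else 0) ∈
        (i.elim (constantIdeal hT) fun c => centeredIdeal hT c : TwoSidedIdeal T) := by
      intro i
      split_ifs with hi
      · exact mem_idealSubspace.1 (hv i hi)
      · exact zero_mem _
    obtain ⟨α, hα⟩ := (mem_constantIdeal hT).1 (hw none)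
    choose s hs using fun c : {c // P c} => (mem_centeredIdeal hT).1 (hw (some c))
    have h0 : blockPattern π α 0 + ∑ c : {c // P c}, s c • centeredBlock π c.1 = 0 := by
      rw [← hα, ← sum_congr rfl fun c _ => hs c, ← Fintype.sum_option
        (fun i => (((if i ∈ S then v i else 0 : T)) : Matrix Ω Ω ℂ)),
        ← AddSubmonoidClass.coe_finsetSum, sum_ite_mem, univ_inter, hsum, ZeroMemClass.coe_zero]
    have hs0 := eq_zero_of_blockPattern_add_sum_eq_zero Subtype.val_injective hn
      (fun c => (hP _).1 c.2) h0
    simp only [hs0, zero_smul, sum_const_zero, add_zero] at h0 hs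
    intro i hi
    apply Subtype.ext
    rcases i with _ | c
    · simpa [hi] using hα.trans h0
    · simpa [hi] using hs c
  · rw [eq_top_iff]
    rintro t -
    obtain ⟨α, β, ht⟩ := (hT t).1 t.2
    have hC : ∀ c, centeredBlock π c ∈ T := fun c => blockPattern_mem hT _ _
    have h : t = ⟨blockPattern π
          (fun a b => α a b + if a = b then β a / fiberCard π a else 0) 0,
          blockPattern_mem hT _ _⟩ +
        ∑ c, (β c / fiberCard π c) • (⟨centeredBlock π c, hC c⟩ : T) := by
      apply Subtype.ext
      rw [ht, blockPattern_eq_add_sum hn]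
      simp
    rw [h]
    refine Submodule.add_mem _ ?_ (Submodule.sum_mem _ fun c _ => Submodule.smul_mem _ _ ?_)
    · exact Submodule.mem_iSup_of_mem none
        (mem_idealSubspace.2 (blockPattern_mem_constantIdeal hT _))
    · by_cases hc : P c
      · exact Submodule.mem_iSup_of_mem (some ⟨c, hc⟩)
          (mem_idealSubspace.2 ((mem_centeredIdeal hT).2 ⟨1, (one_smul _ _).symm⟩))
      · have : (⟨centeredBlock π c, hC c⟩ : T) = 0 := Subtype.ext (not_not.1 fun h => hc ((hP c).2 h))
        rw [this]
        exact zero_mem _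

end BlockPatternIdeals

/-! ### The Terwilliger algebra as an algebra of block patterns. -/

section BlockScheme

open Finset

variable {Ω ι : Type*} [Fintype Ω] [DecidableEq Ω] [DecidableEq ι] {π : Ω → ι}
  {A : ι → Matrix Ω Ω ℂ} {o : Ω}

theorem exists_eq_blockPattern (M : Matrix Ω Ω ℂ)
    (hoff : ∀ x y x' y', π x = π x' → π y = π y' → x ≠ y → x' ≠ y' → M x y = M x' y')
    (hdiag : ∀ x x', π x = π x' → M x x = M x' x') :
    ∃ α β, M = blockPattern π α β := by
  classical
  -- Off-diagonal values are read at a chosen pair of distinct points. A block without such a pair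
  -- gets the default `0`; `β` is the diagonal value minus whatever `α` contributes.
  refine ⟨fun a b => if h : ∃ q : Ω × Ω, π q.1 = a ∧ π q.2 = b ∧ q.1 ≠ q.2 then
      M h.choose.1 h.choose.2 else 0, fun a => (if h : ∃ x, π x = a then M h.choose h.choose else 0) -
      if h : ∃ q : Ω × Ω, π q.1 = a ∧ π q.2 = a ∧ q.1 ≠ q.2 then
      M h.choose.1 h.choose.2 else 0, ?_⟩
  ext x y
  rw [blockPattern_apply]
  by_cases hxy : x = y
  · subst hxy
    have h : ∃ x', π x' = π x := ⟨x, rfl⟩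
    rw [if_pos rfl, add_sub_cancel, dif_pos h]
    exact hdiag _ _ h.choose_spec.symm
  · have h : ∃ q : Ω × Ω, π q.1 = π x ∧ π q.2 = π y ∧ q.1 ≠ q.2 := ⟨(x, y), rfl, rfl, hxy⟩
    rw [if_neg hxy, add_zero, dif_pos h]
    exact hoff _ _ _ _ h.choose_spec.1.symm h.choose_spec.2.1.symm hxy h.choose_spec.2.2

/-- Patterns are closed under the operations and contain the generators. Conversely `∑ i, A i` is
the all-ones matrix `J`, and the products `E_a^* J E_b^*` together with the `E_a^*` span all
patterns. -/
theorem mem_terwilligerAlgebra_iff [Fintype ι]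
    (hbase : ∀ i y, A i o y = if π y = i then 1 else 0)
    (hsum : ∀ x y, ∑ i, A i x y = 1)
    (hpat : ∀ i, ∃ α β, A i = blockPattern π α β) (M : Matrix Ω Ω ℂ) :
    M ∈ terwilligerAlgebra A o ↔ ∃ α β, M = blockPattern π α β := by
  have hdual : ∀ i, dualIdempotent A o i = blockPattern π 0 fun a => if a = i then 1 else 0 := by
    intro i
    ext x y
    by_cases h : x = y <;> simp [dualIdempotent, blockPattern_apply, hbase, h]
  constructor
  · intro hM
    induction hM using Algebra.adjoin_induction with
    | mem M hM =>
      let S : Submodule ℂ (Matrix Ω Ω ℂ) :=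
        { carrier := {M | ∃ α β, M = blockPattern π α β}
          zero_mem' := ⟨0, 0, by ext; simp [blockPattern_apply]⟩
          add_mem' := by
            rintro _ _ ⟨α, β, rfl⟩ ⟨α', β', rfl⟩
            exact ⟨_, _, blockPattern_add _ _ _ _⟩
          smul_mem' := by
            rintro s _ ⟨α, β, rfl⟩
            exact ⟨_, _, smul_blockPattern _ _ _⟩ }
      rcases hM with hM | hM
      · refine (Submodule.span_le (p := S)).2 ?_ hM
        rintro _ ⟨i, rfl⟩
        exact hpat i
      · refine (Submodule.span_le (p := S)).2 ?_ hM
        rintro _ ⟨i, rfl⟩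
        exact ⟨_, _, hdual i⟩
    | algebraMap s =>
      refine ⟨0, fun _ => s, ?_⟩
      ext x y
      simp [blockPattern_apply, Matrix.algebraMap_matrix_apply]
    | add x y _ _ hx hy =>
      obtain ⟨α, β, rfl⟩ := hx
      obtain ⟨α', β', rfl⟩ := hy
      exact ⟨_, _, blockPattern_add _ _ _ _⟩
    | mul x y _ _ hx hy =>
      obtain ⟨α, β, rfl⟩ := hx
      obtain ⟨α', β', rfl⟩ := hy
      exact ⟨_, _, blockPattern_mul _ _ _ _⟩
  · rintro ⟨α, β, rfl⟩
    have hE : ∀ i, dualIdempotent A o i ∈ terwilligerAlgebra A o := fun i =>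
      Algebra.subset_adjoin (Or.inr (Submodule.subset_span ⟨i, rfl⟩))
    have hJ : ∑ i, A i ∈ terwilligerAlgebra A o := sum_mem fun i _ =>
      Algebra.subset_adjoin (Or.inl (Submodule.subset_span ⟨i, rfl⟩))
    have h : blockPattern π α β =
        ∑ a, ∑ b, α a b • (dualIdempotent A o a * (∑ i, A i) * dualIdempotent A o b) +
          ∑ a, β a • dualIdempotent A o a := by
      ext x y
      simp only [Matrix.add_apply, Matrix.sum_apply, Matrix.smul_apply, dualIdempotent,
        Matrix.diagonal_mul, Matrix.mul_diagonal, hsum, hbase, blockPattern_apply,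
        Matrix.diagonal_apply]
      simp
    rw [h]
    exact add_mem (sum_mem fun a _ => sum_mem fun b _ =>
      Subalgebra.smul_mem _ (mul_mem (mul_mem (hE a) hJ) (hE b)) _)
      (sum_mem fun a _ => Subalgebra.smul_mem _ (hE a) _)

/-- The fibre of `o` is a point, so its all-ones block `e` fixes the base vector. Distinct atoms
meet in zero, so for any other atom containing `t` the product `t * M * e` vanishes, hence `t` kills
the primary module. -/
theorem isPrimaryComponent_iff [Fintype ι] [Nonempty ι] (hπ : Function.Surjective π)
    (hA : ∃ i, A i = 1) (ho : ∀ x, π x = π o ↔ x = o)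
    (hT : ∀ M, M ∈ terwilligerAlgebra A o ↔ ∃ α β, M = blockPattern π α β)
    (V : TwoSidedIdeal (terwilligerAlgebra A o)) :
    IsPrimaryComponent A o V ↔ V = constantIdeal hT := by
  have hn : ∀ c, fiberCard π c ≠ 0 := fun c => by
    obtain ⟨x, rfl⟩ := hπ c
    exact Nat.cast_ne_zero.2 (card_ne_zero.2 ⟨x, by simp⟩)
  have hatom := isAtom_constantIdeal hT hn hπ
  let e : terwilligerAlgebra A o := ⟨onesBlock π (π o) (π o), blockPattern_mem hT _ _⟩
  have he : e ∈ constantIdeal hT := blockPattern_mem_constantIdeal hT _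
  have hee : Matrix.mulVec (e : Matrix Ω Ω ℂ) (Pi.single o 1) = Pi.single o 1 := by
    ext x
    rw [Matrix.mulVec_single_one]
    by_cases h : x = o <;> simp [e, onesBlock, blockPattern_apply, ho, h]
  constructor
  · rintro ⟨hV, t, htV, _, ⟨M, hM, rfl⟩, hne⟩
    by_contra hVne
    refine hne ?_
    have hMT : M ∈ terwilligerAlgebra A o := Algebra.subset_adjoin (Or.inl hM)
    have hmem : t * (⟨M, hMT⟩ * e) ∈ V ⊓ constantIdeal hT :=
      (TwoSidedIdeal.mem_inf _).2 ⟨V.mul_mem_right _ _ htV,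
        TwoSidedIdeal.mul_mem_left _ _ _ (TwoSidedIdeal.mul_mem_left _ _ _ he)⟩
    rw [(IsAtom.disjoint_of_ne hV hatom hVne).eq_bot, TwoSidedIdeal.mem_bot] at hmem
    have h0 : (t : Matrix Ω Ω ℂ) * (M * (e : Matrix Ω Ω ℂ)) = 0 := congrArg Subtype.val hmem
    rw [← hee, Matrix.mulVec_mulVec, Matrix.mulVec_mulVec, mul_assoc, h0, Matrix.zero_mulVec]
  · rintro rfl
    obtain ⟨i, hi⟩ := hA
    refine ⟨hatom, e, he, Pi.single o 1, ⟨1, Submodule.subset_span ⟨i, hi⟩, (Matrix.one_mulVec _).symm⟩, ?_⟩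
    rw [hee]
    simp

end BlockScheme

/-! ### Conjugacy classes of the Frobenius group. -/

section Frobenius

variable {G : Type*} [Group G] {K H : Subgroup G}

/-- If `h` commutes with `k`, it lies in both `H` and `k H k⁻¹`, while `k ∉ H`. -/
theorem IsFrobeniusGroup.eq_one_of_commute (hG : IsFrobeniusGroup K H) {k h : G} (hk : k ∈ K)
    (hk1 : k ≠ 1) (hh : h ∈ H) (hc : h * k = k * h) : h = 1 := by
  have hkH : k ∉ H := fun hkH =>
    hk1 (Subgroup.disjoint_def.1 hG.isComplement.disjoint hk hkH)
  have : h ∈ H ⊓ H.map (MulAut.conj k).toMonoidHom :=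
    ⟨hh, h, hh, by simp [← hc]⟩
  rwa [hG.inf_conj_eq_bot k hkH, Subgroup.mem_bot] at this

theorem IsFrobeniusGroup.exists_mul (hG : IsFrobeniusGroup K H) (g : G) :
    ∃ k ∈ K, ∃ h ∈ H, g = k * h := by
  obtain ⟨⟨k, h⟩, hkh⟩ := hG.isComplement.2 g
  exact ⟨k, k.2, h, h.2, hkh.symm⟩

/-- Conjugation by `H` is free on `K \ {1}`, a set of the same size as `H`, so it is transitive. -/
theorem IsFrobeniusGroup.isConj_of_mem [Finite G] (hG : IsFrobeniusGroup K H)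
    (hcard : Nat.card K = Nat.card H + 1) {u v : G} (hu : u ∈ K) (hv : v ∈ K) (hu1 : u ≠ 1)
    (hv1 : v ≠ 1) : IsConj u v := by
  have := hG.kernel_normal
  let f : H → {k : K // k ≠ 1} := fun h =>
    ⟨⟨h * u * h⁻¹, this.conj_mem u hu h⟩, fun h1 => hu1 (by simpa using congrArg Subtype.val h1)⟩
  have hf : Function.Injective f := by
    intro h h' heq
    have heq : (h : G) * u * (h : G)⁻¹ = h' * u * (h' : G)⁻¹ :=
      congrArg (fun k => (k.1 : G)) heq
    have h1 := hG.eq_one_of_commute hu hu1 (H.mul_mem (H.inv_mem h'.2) h.2)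
      (by
        rw [mul_inv_eq_iff_eq_mul] at heq
        rw [mul_assoc, heq]
        group)
    exact Subtype.ext (inv_mul_eq_one.1 h1).symm
  have hc : Nat.card {k : K // k ≠ 1} = Nat.card H := by
    classical
    have := Nat.card_congr (Equiv.sumCompl fun k : K => k = 1)
    rw [Nat.card_sum, Nat.card_unique, hcard] at this
    change Nat.card {k : K // ¬ k = 1} = _
    omega
  obtain ⟨h, hh⟩ := ((Nat.bijective_iff_injective_and_card f).2 ⟨hf, hc.symm⟩).2
    ⟨⟨v, hv⟩, fun h => hv1 (congrArg Subtype.val h)⟩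
  exact isConj_iff.2 ⟨h, congrArg (fun k => (k.1 : G)) hh⟩

/-- The commutator map `k ↦ k u k⁻¹ u⁻¹` on `K` is injective, hence onto. A collision gives `w ≠ 1`
in `K` commuting with `u = a h`, hence with `h` because `K` is abelian; then `h = 1` and `u ∈ K`. -/
theorem IsFrobeniusGroup.isConj_of_notMem [Finite G] (hG : IsFrobeniusGroup K H)
    (hKc : ∀ a ∈ K, ∀ b ∈ K, a * b = b * a) {u v : G} (hu : u ∉ K) (huv : v * u⁻¹ ∈ K) :
    IsConj u v := by
  have hnor := hG.kernel_normal
  let f : K → K := fun k => ⟨k * (u * (k : G)⁻¹ * u⁻¹),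
    K.mul_mem k.2 (hnor.conj_mem _ (K.inv_mem k.2) u)⟩
  have hf : Function.Injective f := by
    intro k k' heq
    have heq : (k : G) * (u * (k : G)⁻¹ * u⁻¹) = k' * (u * (k' : G)⁻¹ * u⁻¹) :=
      congrArg Subtype.val heq
    by_contra hne
    obtain ⟨a, ha, h, hh, rfl⟩ := hG.exists_mul u
    have hwK := K.mul_mem (K.inv_mem k'.2) k.2
    set w := (k' : G)⁻¹ * k with hw
    have hw1 : w ≠ 1 := fun h1 => hne (Subtype.ext (inv_mul_eq_one.1 h1).symm)
    have hcomm : a * h * w = w * (a * h) := by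
      have h2 : w * (a * h) = a * h * (k' : G)⁻¹ * k := by
        calc w * (a * h) = (k' : G)⁻¹ * ((k : G) * (a * h * (k : G)⁻¹ * (a * h)⁻¹))
              * (a * h) * k := by rw [hw]; group
          _ = _ := by rw [heq]; group
      rw [h2, hw]
      group
    have hcomm' : h * w = w * h := by
      apply mul_left_cancel (a := a)
      rw [← mul_assoc, hcomm, ← mul_assoc, ← mul_assoc, hKc a ha w hwK]
    have h1 := hG.eq_one_of_commute hwK hw1 hh hcomm'
    exact hu (by simpa [h1] using ha)
  obtain ⟨k, hk⟩ := Finite.surjective_of_injective hf ⟨v * u⁻¹, huv⟩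
  have hk : (k : G) * (u * (k : G)⁻¹ * u⁻¹) = v * u⁻¹ := congrArg Subtype.val hk
  refine isConj_iff.2 ⟨k, ?_⟩
  rw [eq_mul_inv_iff_mul_eq] at hk
  rw [← hk]
  group

/-- The quotient by `K` is abelian, being an image of `H`. -/
theorem IsFrobeniusGroup.mul_inv_mem_of_isConj (hG : IsFrobeniusGroup K H)
    (hHc : ∀ a ∈ H, ∀ b ∈ H, a * b = b * a) {u v : G} (huv : IsConj u v) : v * u⁻¹ ∈ K := by
  have hnor := hG.kernel_normal
  obtain ⟨g, rfl⟩ := isConj_iff.1 huv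
  obtain ⟨a, ha, h, hh, rfl⟩ := hG.exists_mul g
  obtain ⟨b, hb, l, hl, rfl⟩ := hG.exists_mul u
  have hq : ∀ k ∈ K, (QuotientGroup.mk' K) k = 1 := fun k hk =>
    (QuotientGroup.eq_one_iff k).2 hk
  rw [← QuotientGroup.eq_one_iff, ← QuotientGroup.mk'_apply]
  simp only [map_mul, map_inv, hq a ha, hq b hb, one_mul]
  rw [← map_mul, hHc h hh l hl, map_mul]
  group

theorem IsFrobeniusGroup.isConj_iff_mul_inv_mem [Finite G] (hG : IsFrobeniusGroup K H)
    (hKc : ∀ a ∈ K, ∀ b ∈ K, a * b = b * a) (hHc : ∀ a ∈ H, ∀ b ∈ H, a * b = b * a)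
    (hcard : Nat.card K = Nat.card H + 1) {u v : G} (hu : u ≠ 1) (hv : v ≠ 1) :
    IsConj u v ↔ v * u⁻¹ ∈ K := by
  refine ⟨hG.mul_inv_mem_of_isConj hHc, fun h => ?_⟩
  by_cases huK : u ∈ K
  · refine hG.isConj_of_mem hcard huK ?_ hu hv
    simpa using K.mul_mem h huK
  · exact hG.isConj_of_notMem hKc huK h

theorem exists_ne_of_two_lt_card [Finite G] (hK : 2 < Nat.card K) (a b : G) :
    ∃ k ∈ K, k ≠ a ∧ k ≠ b := by
  by_contra! h
  have : (K : Set G) ⊆ {a, b} := fun k hk => by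
    by_cases hka : k = a
    · exact Or.inl hka
    · exact Or.inr (h k hk hka)
  have h2 := Set.ncard_le_ncard this
  have h3 := Set.ncard_insert_le a {b}
  rw [Set.ncard_singleton] at h3
  have h4 : (K : Set G).ncard = Nat.card K := rfl
  omega

theorem IsFrobeniusGroup.card_conjClasses [Finite G] (hG : IsFrobeniusGroup K H)
    (hconj : ∀ u v : G, u ≠ 1 → v ≠ 1 → (IsConj u v ↔ v * u⁻¹ ∈ K))
    (hK : 2 < Nat.card K) : Nat.card (ConjClasses G) = Nat.card H + 1 := by
  have hmem : ∀ h : H, ∃ k ∈ K, k * (h : G) ≠ 1 := fun h => by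
    -- Each coset of `K` needs a nonidentity representative, including `K` itself, where `h = 1`.
    obtain ⟨k, hk, hk1, -⟩ := exists_ne_of_two_lt_card hK (h : G)⁻¹ 1
    exact ⟨k, hk, fun h1 => hk1 (eq_inv_of_mul_eq_one_left h1)⟩
  choose k hk hk1 using hmem
  let f : H → {c : ConjClasses G // ¬ c = 1} := fun h =>
    ⟨ConjClasses.mk (k h * h), fun h1 => hk1 h (by
      rw [ConjClasses.one_eq_mk_one, ConjClasses.mk_eq_mk_iff_isConj] at h1
      exact isConj_one_left.1 h1)⟩
  have hf : Function.Bijective f := by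
    have hnor := hG.kernel_normal
    constructor
    · intro h h' heq
      have h1 := ConjClasses.mk_eq_mk_iff_isConj.1 (congrArg Subtype.val heq)
      rw [hconj _ _ (hk1 h) (hk1 h')] at h1
      have h2 : (h' : G) * (h : G)⁻¹ ∈ K := by
        have hq : ∀ h, (QuotientGroup.mk' K) (k h) = 1 := fun h =>
          (QuotientGroup.eq_one_iff _).2 (hk h)
        rw [← QuotientGroup.eq_one_iff, ← QuotientGroup.mk'_apply] at h1 ⊢
        simpa only [map_mul, map_inv, hq, one_mul] using h1
      have h3 := Subgroup.disjoint_def.1 hG.isComplement.disjoint h2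
        (H.mul_mem h'.2 (H.inv_mem h.2))
      exact Subtype.ext (mul_inv_eq_one.1 h3).symm
    · rintro ⟨c, hc⟩
      obtain ⟨g, rfl⟩ := ConjClasses.exists_rep c
      have hg : g ≠ 1 := by
        rintro rfl
        exact hc rfl
      obtain ⟨a, ha, h, hh, rfl⟩ := hG.exists_mul g
      refine ⟨⟨h, hh⟩, Subtype.ext (ConjClasses.mk_eq_mk_iff_isConj.2 ?_)⟩
      rw [hconj _ _ (hk1 _) hg]
      have := K.mul_mem ha (K.inv_mem (hk ⟨h, hh⟩))
      convert this using 1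
      simp [mul_assoc]
  classical
  have := Nat.card_congr (Equiv.sumCompl fun c : ConjClasses G => c = 1)
  rw [Nat.card_sum, Nat.card_unique, ← Nat.card_congr (Equiv.ofBijective f hf)] at this
  omega

theorem groupScheme_eq_blockPattern [Fintype G] [DecidableEq G] [K.Normal]
    (hconj : ∀ u v : G, u ≠ 1 → v ≠ 1 → (IsConj u v ↔ v * u⁻¹ ∈ K))
    (c : ConjClasses G) :
    ∃ α β, groupScheme G c = blockPattern ConjClasses.mk α β := by
  have hq : ∀ u v : G, v * u⁻¹ ∈ K ↔ (u : G ⧸ K) = v := fun u v => by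
    rw [← QuotientGroup.eq_one_iff, QuotientGroup.mk_mul, QuotientGroup.mk_inv, mul_inv_eq_one,
      eq_comm]
  have hmk : ∀ u v : G, ConjClasses.mk u = ConjClasses.mk v → (u : G ⧸ K) = v := by
    intro u v h
    rw [ConjClasses.mk_eq_mk_iff_isConj] at h
    by_cases hu : u = 1
    · subst hu
      rw [isConj_one_right.1 h]
    · by_cases hv : v = 1
      · exact absurd (isConj_one_left.1 (hv ▸ h)) hu
      · exact (hq u v).1 ((hconj u v hu hv).1 h)
  have hmem : ∀ u v : G, ConjClasses.mk u = ConjClasses.mk v →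
      (u ∈ c.carrier ↔ v ∈ c.carrier) := fun u v h => by
    simp only [ConjClasses.mem_carrier_iff_mk_eq, h]
  classical
  apply exists_eq_blockPattern
  · intro x y x' y' hx hy hxy hxy'
    have h : ConjClasses.mk (y * x⁻¹) = ConjClasses.mk (y' * x'⁻¹) := by
      rw [ConjClasses.mk_eq_mk_iff_isConj, hconj _ _ (by rwa [Ne, mul_inv_eq_one, eq_comm])
        (by rwa [Ne, mul_inv_eq_one, eq_comm]), hq]
      simp only [QuotientGroup.mk_mul, QuotientGroup.mk_inv, hmk _ _ hx, hmk _ _ hy]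
    exact if_congr (hmem _ _ h) rfl rfl
  · intro x x' _
    exact if_congr (by simp) rfl rfl

theorem ncard_carrier [Fintype G] [DecidableEq (ConjClasses G)] (c : ConjClasses G) :
    (c.carrier.ncard : ℂ) = fiberCard ConjClasses.mk c := by
  rw [fiberCard, ← Set.ncard_coe_finset]
  congr 2
  ext x
  simp [ConjClasses.mem_carrier_iff_mk_eq]

/-- Some `k ∈ K` differs from both `1` and `x⁻¹`, so `k * x` is a second element of the class of
`x`. -/
theorem fiberCard_ne_one [Fintype G] [DecidableEq (ConjClasses G)]
    (hconj : ∀ u v : G, u ≠ 1 → v ≠ 1 → (IsConj u v ↔ v * u⁻¹ ∈ K)) (hK : 2 < Nat.card K)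
    {c : ConjClasses G} (hc : c ≠ 1) : fiberCard ConjClasses.mk c ≠ 1 := by
  obtain ⟨x, rfl⟩ := ConjClasses.exists_rep c
  have hx : x ≠ 1 := by
    rintro rfl
    exact hc rfl
  obtain ⟨k, hk, hk1, hkx⟩ := exists_ne_of_two_lt_card hK 1 x⁻¹
  have hxk : IsConj (k * x) x := IsConj.symm <|
    (hconj _ _ hx fun h => hkx (eq_inv_of_mul_eq_one_left h)).2 (by simpa using hk)
  have : 1 < Finset.card {y | ConjClasses.mk y = ConjClasses.mk x} :=
    Finset.one_lt_card.2 ⟨x, by simp, k * x,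
      by simpa [ConjClasses.mk_eq_mk_iff_isConj] using hxk, by simpa [eq_comm] using hk1⟩
  rw [fiberCard, Nat.cast_ne_one]
  exact this.ne'

theorem centeredBlock_one [Fintype G] [DecidableEq G] [DecidableEq (ConjClasses G)] :
    centeredBlock (ConjClasses.mk : G → ConjClasses G) 1 = 0 := by
  have h1 : ∀ x : G, ConjClasses.mk x = 1 ↔ x = 1 := fun x => by
    rw [ConjClasses.one_eq_mk_one, ConjClasses.mk_eq_mk_iff_isConj, isConj_one_left]
  ext x y
  simp only [centeredBlock, blockPattern_apply, fiberCard, h1]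
  by_cases hx : x = 1 <;> by_cases hy : y = 1 <;> simp [hx, hy, eq_comm, Finset.filter_eq']

theorem blockMatrix_eq_smul_centeredBlock [Fintype G] [DecidableEq G]
    [DecidableEq (ConjClasses G)] {c : ConjClasses G}
    (hc : fiberCard ConjClasses.mk c - 1 ≠ 0) :
    blockMatrix G c = (fiberCard ConjClasses.mk c - 1)⁻¹ • centeredBlock ConjClasses.mk c := by
  ext x y
  simp only [blockMatrix, ncard_carrier, centeredBlock, blockPattern_apply, Matrix.smul_apply,
    Matrix.of_apply, ConjClasses.mem_carrier_iff_mk_eq, Matrix.one_apply, smul_eq_mul]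
  by_cases hxy : x = y
  · subst hxy
    by_cases hx : ConjClasses.mk x = c
    · simp only [hx, and_self, if_true]
      field_simp
      ring
    · simp [hx]
  · by_cases hx : ConjClasses.mk x = c ∧ ConjClasses.mk y = c
    · simp only [hx, hxy, if_false, and_self, if_true]
      field_simp
      ring
    · simp [hx, hxy]

end Frobenius

/-! ### Assembly of the main theorem. -/

theorem theorem5 {G : Type*} [Group G] [Fintype G] [DecidableEq G]
    (p r : ℕ) (hp : p.Prime) (hr : 1 ≤ r) (K H : Subgroup G) (hG : IsFrobeniusGroup K H)
    (hK : Nonempty (K ≃* Multiplicative (Fin r → ZMod p)))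
    (hH : Nonempty (H ≃* Multiplicative (ZMod (p ^ r - 1)))) :
    Nat.card (ConjClasses G) = p ^ r ∧
    ∃ (V : TwoSidedIdeal (groupTerwilliger G))
      (W : {c : ConjClasses G // c ≠ 1} → TwoSidedIdeal (groupTerwilliger G)),
      (∀ V', IsPrimaryComponent (groupScheme G) 1 V' ↔ V' = V) ∧
      Module.finrank ℂ (idealSubspace V) = (p ^ r) ^ 2 ∧
      (∀ c : {c : ConjClasses G // c ≠ 1},
        (idealSubspace (W c)).map (groupTerwilliger G).val.toLinearMap =
        Submodule.span ℂ {blockMatrix G c.1}) ∧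
      (∀ c, Module.finrank ℂ (idealSubspace (W c)) = 1) ∧
      (∀ c : {c : ConjClasses G // c ≠ 1}, IsIdempotentElem
        ((((c.1.carrier.ncard : ℂ) - 1) / (c.1.carrier.ncard : ℂ)) • blockMatrix G c.1)) ∧
      IsWedderburnDecomposition (fun k : Option {c : ConjClasses G // c ≠ 1} => k.elim V W) := by
  classical
  obtain ⟨eK⟩ := hK
  obtain ⟨eH⟩ := hH
  have hnor := hG.kernel_normal
  have := Fact.mk hp
  have hKc : ∀ a ∈ K, ∀ b ∈ K, a * b = b * a := fun a ha b hb =>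
    congrArg Subtype.val (eK.injective (by rw [map_mul, map_mul, mul_comm]) :
      (⟨a, ha⟩ : K) * ⟨b, hb⟩ = ⟨b, hb⟩ * ⟨a, ha⟩)
  have hHc : ∀ a ∈ H, ∀ b ∈ H, a * b = b * a := fun a ha b hb =>
    congrArg Subtype.val (eH.injective (by rw [map_mul, map_mul, mul_comm]) :
      (⟨a, ha⟩ : H) * ⟨b, hb⟩ = ⟨b, hb⟩ * ⟨a, ha⟩)
  have hcK : Nat.card K = p ^ r := by
    rw [Nat.card_congr eK.toEquiv, Nat.card_congr Multiplicative.toAdd, Nat.card_fun]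
    simp
  have hcH : Nat.card H = p ^ r - 1 := by
    rw [Nat.card_congr eH.toEquiv, Nat.card_congr Multiplicative.toAdd, Nat.card_zmod]
  -- Nontriviality of the complement forces `p ^ r > 2` and makes the truncated subtraction `p ^ r -
  -- 1` harmless.
  have hcH1 : 1 < Nat.card H := H.one_lt_card_iff_ne_bot.2 hG.complement_ne_bot
  have hcard : Nat.card K = Nat.card H + 1 := by omega
  have hK2 : 2 < Nat.card K := by omega
  have hconj : ∀ u v : G, u ≠ 1 → v ≠ 1 → (IsConj u v ↔ v * u⁻¹ ∈ K) := fun u v =>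
    hG.isConj_iff_mul_inv_mem hKc hHc hcard
  have hcc : Nat.card (ConjClasses G) = p ^ r := by
    rw [hG.card_conjClasses hconj hK2, ← hcard, hcK]
  let π : G → ConjClasses G := ConjClasses.mk
  have hπ : Function.Surjective π := ConjClasses.mk_surjective
  have hbase : ∀ i y, groupScheme G i 1 y = if π y = i then 1 else 0 := fun i y => by
    simp [groupScheme, ConjClasses.mem_carrier_iff_mk_eq, π]
  have hsum : ∀ x y, ∑ i, groupScheme G i x y = 1 := fun x y => by
    simp [groupScheme, ConjClasses.mem_carrier_iff_mk_eq]
  have hone : ∀ x, π x = π 1 ↔ x = 1 := fun x => by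
    rw [ConjClasses.mk_eq_mk_iff_isConj, isConj_one_left]
  have hT : ∀ M, M ∈ groupTerwilliger G ↔ ∃ α β, M = blockPattern π α β :=
    mem_terwilligerAlgebra_iff hbase hsum (groupScheme_eq_blockPattern hconj)
  have hA : ∃ i, groupScheme G i = 1 := ⟨1, by
    ext x y
    rw [Matrix.one_apply]
    refine if_congr ?_ rfl rfl
    exact ConjClasses.mem_carrier_iff_mk_eq.trans
      ((hone _).trans (mul_inv_eq_one.trans eq_comm))⟩
  have hn1 : ∀ c : ConjClasses G, c ≠ 1 → fiberCard π c - 1 ≠ 0 := fun c hc =>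
    sub_ne_zero.2 (fiberCard_ne_one hconj hK2 hc)
  have hne : ∀ c : ConjClasses G, c ≠ 1 ↔ centeredBlock π c ≠ 0 := by
    intro c
    constructor
    · intro hc h
      obtain ⟨x, rfl⟩ := hπ c
      apply hn1 _ hc
      rw [← centeredBlock_apply_self, h, Matrix.zero_apply]
    · rintro h rfl
      exact h centeredBlock_one
  have hblock : ∀ c : ConjClasses G, c ≠ 1 →
      blockMatrix G c = (fiberCard π c - 1)⁻¹ • centeredBlock π c := fun c hc =>
    blockMatrix_eq_smul_centeredBlock (hn1 c hc)
  refine ⟨hcc, constantIdeal hT, fun c => centeredIdeal hT c,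
    isPrimaryComponent_iff hπ hA hone hT, ?_, fun c => ?_,
    fun c => finrank_centeredIdeal hT ((hne c).1 c.2), fun c => ?_,
    isWedderburnDecomposition hT hπ _ hne⟩
  · rw [finrank_constantIdeal hT hπ, ← Nat.card_eq_fintype_card, hcc]
  · rw [map_centeredIdeal, hblock c c.2,
      Submodule.span_singleton_smul_eq (IsUnit.mk0 _ (inv_ne_zero (hn1 c c.2)))]
  · have hn0 : fiberCard π c.1 ≠ 0 := by
      obtain ⟨x, hx⟩ := hπ c.1
      exact Nat.cast_ne_zero.2 (Finset.card_ne_zero.2 ⟨x, by simp [hx]⟩)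
    have hn1c := hn1 c c.2
    -- The rescaled matrix is `(n I - J) / n` with `n` the class size, idempotent since `(n I - J)²
    -- = n (n I - J)`.
    have hs : (fiberCard π c.1 - 1) / fiberCard π c.1 * (fiberCard π c.1 - 1)⁻¹ =
        (fiberCard π c.1)⁻¹ := by
      field_simp
    rw [IsIdempotentElem, hblock c c.2, ncard_carrier, smul_smul, hs, Matrix.smul_mul,
      Matrix.mul_smul, centeredBlock_mul_self, smul_smul (fiberCard π c.1)⁻¹ (fiberCard π c.1),
      inv_mul_cancel₀ hn0, one_smul]
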